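/- **Setting.** Let $G=(V,E)$ be a finite simple graph with an arbitrary orientation of each edge. Fix finite-dimensional real inner product spaces $\mathcal F(v)$ ($v\in V$) and $\mathcal F(e)$ ($e\in E$). A sheaf with these stalks is a choice of linear maps $\mathcal F_{v\unlhd e}:\mathcal F(v)\to\mathcal F(e)$, one for each incidence $v\in e$; it is encoded by its coboundary operator $\delta:C^0=\bigoplus_v\mathcal F(v)\to C^1=\bigoplus_e\mathcal F(e)$, $(\delta x)_e=\mathcal F_{v\unlhd e}x_v-\mathcal F_{u\unlhd e}x_u$ for $e=u\to v$. The space $\mathrm{Hom}(C^0,C^1)$ carries the Frobenius inner product $\langle A,B\rangle_F=\operatorname{tr}(A^TB)$. For each $v$ let $S_v\subseteq\mathcal F(v)$ be a subspace (stubborn directions) and $T_v=S_v^\perp$; let $u\in\bigoplus_vS_v$ be fixed stubborn opinions, $y\in C^0(\mathcal Q)=\bigoplus_vT_v$ the free opinions, $x=u+y\in C^0$ the total opinion state, and $P_{\mathcal Q}$ the orthogonal projection of $C^0$ onto $C^0(\mathcal Q)$. Let $\mathcal I$ be a set of incidences (the adapting ones), $\mathcal M$ the space of coboundary operators of families of restriction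 maps that vanish at every incidence outside $\mathcal I$, and $\Pi_{\mathcal M}$ the Frobenius-orthogonal projection onto $\mathcal M$. An edge is of Type S if both or neither of its two incidences lie in $\mathcal I$, and of Type A if exactly one does; $E_A$ is the set of Type A edges. For $\alpha,\beta>0$ the constrained joint dynamics are $$\frac{dy}{dt}=-\alpha\,P_{\mathcal Q}(\delta^T\delta x),\qquad \frac{d\delta}{dt}=-\beta\,\Pi_{\mathcal M}(\delta x x^T).$$ A solution is a pair $(y(t),\delta(t))$ satisfying these equations on a time interval $J\subseteq[0,\infty)$ with $0\in J$, where $\delta(t)$ is the coboundary operator of a sheaf with the given stalks. Initial conditions $(y_0,\delta_0)$ are arbitrary, including the values of the non-adapting restriction maps. **Theorem (Convergence of Constrained Joint Diffusion).** 1. Along every solution the disagreement energy $\Psi(y,\delta)=\tfrac12\|\delta x\|^2$ is nonincreasing. 2. If every edge is of Type S (equivalently, $E_A=\varnothing$), then $\|\delta\|_F$ is nonincreasing along every solution. Conversely: (a) for a given $u$, suppose that every Type A edge $e$ has $\mathcal F(e)\ne0$ and that at each endpoint $v$ of $e$ the opinion is not forced to vanish, i.e. $u_v\neq0$ or $T_v\neq0$.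 If $\|\delta\|_F$ is nonincreasing along every solution with stubborn opinions $u$, then every edge is of Type S. (b) Suppose that every Type A edge and its two endpoints have nonzero stalks. If $\|\delta\|_F$ is nonincreasing along every solution for every choice of stubborn opinions $u$, then every edge is of Type S. 3. If a solution $(y,\delta)$ is defined on $[0,\infty)$ and its forward orbit $\{(y(t),\delta(t)):t\ge0\}$ is precompact, then it converges to the set of equilibria: as $t\to\infty$, the distance from $(y(t),\delta(t))$ to the set of all $(y^*,\delta^*)$ at which both right-hand sides vanish and whose non-adapting restriction maps equal those of $\delta(0)$ tends to $0$. -/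

import Mathlib

open Set Filter Topology
open scoped InnerProductSpace

noncomputable section

/-! ### Linear maps with the Frobenius inner product -/

/-- The space `Hom(E, F)` of linear maps between finite-dimensional real inner product spaces,
regarded as an inner product space under the Frobenius inner product `⟪A, B⟫ = tr (Aᵀ B)`. -/
def FrobHom (E F : Type*) [NormedAddCommGroup E] [InnerProductSpace ℝ E]
    [NormedAddCommGroup F] [InnerProductSpace ℝ F] : Type _ :=
  E →ₗ[ℝ] F

namespace FrobHom

section Basic

variable {E F : Type*} [NormedAddCommGroup E] [InnerProductSpace ℝ E]
  [NormedAddCommGroup F] [InnerProductSpace ℝ F]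

instance instAddCommGroup : AddCommGroup (FrobHom E F) :=
  inferInstanceAs (AddCommGroup (E →ₗ[ℝ] F))

instance instModule : Module ℝ (FrobHom E F) :=
  inferInstanceAs (Module ℝ (E →ₗ[ℝ] F))

/-- Forget the Frobenius structure. -/
def toLin : FrobHom E F ≃ₗ[ℝ] (E →ₗ[ℝ] F) :=
  LinearEquiv.refl ℝ (E →ₗ[ℝ] F)

/-- View a linear map as an element of the Frobenius space. -/
def ofLin : (E →ₗ[ℝ] F) ≃ₗ[ℝ] FrobHom E F :=
  toLin.symm

variable [FiniteDimensional ℝ E] [FiniteDimensional ℝ F]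

/-- The Frobenius inner product `tr (Aᵀ B)`. -/
def frobInner (A B : FrobHom E F) : ℝ :=
  LinearMap.trace ℝ E (LinearMap.adjoint (toLin A) ∘ₗ toLin B)

theorem frobInner_eq_sum {ι : Type*} [Fintype ι] (b : OrthonormalBasis ι ℝ E)
    (A B : FrobHom E F) :
    frobInner A B = ∑ i, ⟪toLin A (b i), toLin B (b i)⟫_ℝ := by
  rw [frobInner, LinearMap.trace_eq_sum_inner _ b]
  simp [LinearMap.adjoint_inner_right]

/-- `tr (Aᵀ B)` is an inner product. -/
@[reducible]
def frobCore : InnerProductSpace.Core ℝ (FrobHom E F) where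
  inner := frobInner
  conj_inner_symm A B := by
    simp only [frobInner_eq_sum (stdOrthonormalBasis ℝ E), conj_trivial]
    exact Finset.sum_congr rfl fun i _ => real_inner_comm _ _
  re_inner_nonneg A := by
    simp only [frobInner_eq_sum (stdOrthonormalBasis ℝ E), RCLike.re_to_real]
    exact Finset.sum_nonneg fun i _ =>
      real_inner_self_nonneg (x := toLin A (stdOrthonormalBasis ℝ E i))
  add_left A B C := by
    simp only [frobInner_eq_sum (stdOrthonormalBasis ℝ E), map_add, LinearMap.add_apply,
      inner_add_left, Finset.sum_add_distrib]
  smul_left A B r := by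
    simp only [frobInner_eq_sum (stdOrthonormalBasis ℝ E), map_smul, LinearMap.smul_apply,
      real_inner_smul_left, Finset.mul_sum, conj_trivial]
  definite A h := by
    simp only [frobInner_eq_sum (stdOrthonormalBasis ℝ E)] at h
    have h0 := (Finset.sum_eq_zero_iff_of_nonneg
      (fun i _ => real_inner_self_nonneg (x := toLin A (stdOrthonormalBasis ℝ E i)))).1 h
    apply toLin.injective
    rw [map_zero]
    refine (stdOrthonormalBasis ℝ E).toBasis.ext fun i => ?_
    have h1 := inner_self_eq_zero.1 (h0 i (Finset.mem_univ i))
    simpa using h1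

instance instNormedAddCommGroup : NormedAddCommGroup (FrobHom E F) :=
  (frobCore (E := E) (F := F)).toNormedAddCommGroup

instance instInnerProductSpace : InnerProductSpace ℝ (FrobHom E F) :=
  InnerProductSpace.ofCore (frobCore (E := E) (F := F)).toCore

instance instFiniteDimensional : FiniteDimensional ℝ (FrobHom E F) :=
  inferInstanceAs (FiniteDimensional ℝ (E →ₗ[ℝ] F))

theorem inner_def (A B : FrobHom E F) :
    ⟪A, B⟫_ℝ = LinearMap.trace ℝ E (LinearMap.adjoint (toLin A) ∘ₗ toLin B) :=
  rfl

end Basic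

end FrobHom

/-! ### Incidences, orientations, edge types -/

section Graph

variable {V : Type*}

/-- An incidence `v ⊴ e` of a graph. -/
structure Incidence (G : SimpleGraph V) where
  /-- the vertex -/
  v : V
  /-- the edge -/
  e : G.edgeSet
  /-- the vertex is an endpoint of the edge -/
  inc : v ∈ (e : Sym2 V)

/-- A choice of orientation `src e → tgt e` of every edge. -/
structure EdgeOrientation (G : SimpleGraph V) where
  /-- initial vertex -/
  src : G.edgeSet → V
  /-- terminal vertex -/
  tgt : G.edgeSet → V
  /-- the two are the endpoints of the edge -/
  ends : ∀ e, s(src e, tgt e) = (e : Sym2 V)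

variable {G : SimpleGraph V}

/-- The incidence of an edge with its initial vertex. -/
def EdgeOrientation.srcInc (o : EdgeOrientation G) (e : G.edgeSet) : Incidence G :=
  ⟨o.src e, e, by rw [← o.ends e]; exact Sym2.mem_mk_left _ _⟩

/-- The incidence of an edge with its terminal vertex. -/
def EdgeOrientation.tgtInc (o : EdgeOrientation G) (e : G.edgeSet) : Incidence G :=
  ⟨o.tgt e, e, by rw [← o.ends e]; exact Sym2.mem_mk_right _ _⟩

/-- Type S edge, for a set `I` of adapting incidences: both incidences have the same status. -/
def IsTypeS (I : Set (Incidence G)) (e : G.edgeSet) : Prop :=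
  ∀ p q : Incidence G, p.e = e → q.e = e → (p ∈ I ↔ q ∈ I)

/-- Type A edge: exactly one of the two incidences adapts. -/
def IsTypeA (I : Set (Incidence G)) (e : G.edgeSet) : Prop :=
  ∃ p q : Incidence G, p.e = e ∧ q.e = e ∧ p ∈ I ∧ q ∉ I

/-- The set `E_A` of Type A edges. -/
def typeAEdges (I : Set (Incidence G)) : Set G.edgeSet :=
  {e | IsTypeA I e}

end Graph

/-! ### Cochains, restriction maps, coboundary -/

/-- The cochain space `⨁ i, F i` with the direct sum inner product. -/
abbrev Cochain {ι : Type*} (F : ι → Type*) : Type _ :=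
  PiLp 2 F

section Sheaf

variable {V : Type*} [Fintype V] {G : SimpleGraph V} [Fintype G.edgeSet]
  (Fv : V → Type*) [∀ v, NormedAddCommGroup (Fv v)] [∀ v, InnerProductSpace ℝ (Fv v)]
  (Fe : G.edgeSet → Type*) [∀ e, NormedAddCommGroup (Fe e)]
  [∀ e, InnerProductSpace ℝ (Fe e)]

/-- A family of restriction maps `Fv v → Fe e`, one for every incidence: together with the
stalks, this is a cellular sheaf on `G`. -/
abbrev RestrictionMaps : Type _ :=
  ∀ p : Incidence G, Fv p.v →ₗ[ℝ] Fe p.e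

variable {Fv Fe}

/-- The restriction map from the initial vertex of an edge. -/
def srcMap (o : EdgeOrientation G) (ρ : RestrictionMaps Fv Fe) (e : G.edgeSet) :
    Fv (o.src e) →ₗ[ℝ] Fe e :=
  ρ (o.srcInc e)

/-- The restriction map from the terminal vertex of an edge. -/
def tgtMap (o : EdgeOrientation G) (ρ : RestrictionMaps Fv Fe) (e : G.edgeSet) :
    Fv (o.tgt e) →ₗ[ℝ] Fe e :=
  ρ (o.tgtInc e)

/-- `(δ x)_e = ρ_{v ⊴ e} x_v - ρ_{u ⊴ e} x_u` for `e = u → v`, as a linear map in `x`. -/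
def coboundaryLin (o : EdgeOrientation G) (ρ : RestrictionMaps Fv Fe) :
    Cochain Fv →ₗ[ℝ] Cochain Fe where
  toFun x := WithLp.toLp 2 fun e => tgtMap o ρ e (x (o.tgt e)) - srcMap o ρ e (x (o.src e))
  map_add' x y := by
    ext e
    simp only [PiLp.add_apply, map_add]
    abel
  map_smul' r x := by
    ext e
    simp only [PiLp.smul_apply, RingHom.id_apply, smul_sub, map_smul]

/-- The coboundary operator of a sheaf, depending linearly on its restriction maps. -/
def coboundary (o : EdgeOrientation G) :
    RestrictionMaps Fv Fe →ₗ[ℝ] FrobHom (Cochain Fv) (Cochain Fe) where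
  toFun ρ := FrobHom.ofLin (coboundaryLin o ρ)
  map_add' ρ ρ' := by
    rw [← map_add]
    congr 1
    refine LinearMap.ext fun x => ?_
    ext e
    change (tgtMap o ρ e (x (o.tgt e)) + tgtMap o ρ' e (x (o.tgt e))) -
      (srcMap o ρ e (x (o.src e)) + srcMap o ρ' e (x (o.src e))) =
      (tgtMap o ρ e (x (o.tgt e)) - srcMap o ρ e (x (o.src e))) +
      (tgtMap o ρ' e (x (o.tgt e)) - srcMap o ρ' e (x (o.src e)))
    abel
  map_smul' r ρ := by
    rw [RingHom.id_apply, ← map_smul]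
    congr 1
    refine LinearMap.ext fun x => ?_
    ext e
    change r • tgtMap o ρ e (x (o.tgt e)) - r • srcMap o ρ e (x (o.src e)) =
      r • (tgtMap o ρ e (x (o.tgt e)) - srcMap o ρ e (x (o.src e)))
    rw [smul_sub]

variable (Fv Fe)

/-- The space of coboundary operators of all sheaves with the given stalks. -/
def coboundarySpace (o : EdgeOrientation G) :
    Submodule ℝ (FrobHom (Cochain Fv) (Cochain Fe)) :=
  LinearMap.range (coboundary o)

/-- The subspace `M` of structure velocities that leave every non-adapting restriction map
unchanged. -/
def velocitySpace (o : EdgeOrientation G) (I : Set (Incidence G)) :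
    Submodule ℝ (FrobHom (Cochain Fv) (Cochain Fe)) :=
  Submodule.map (coboundary o)
    (⨅ p ∈ Iᶜ, LinearMap.ker (LinearMap.proj p :
      RestrictionMaps Fv Fe →ₗ[ℝ] (Fv (Incidence.v p) →ₗ[ℝ] Fe (Incidence.e p))))

end Sheaf

/-! ### Stubborn and free opinions -/

section Opinions

variable {V : Type*} [Fintype V] {Fv : V → Type*} [∀ v, NormedAddCommGroup (Fv v)]
  [∀ v, InnerProductSpace ℝ (Fv v)]

/-- `⨁ v, W v` as a subspace of the space of `0`-cochains. -/
def cochainSubspace (W : ∀ v, Submodule ℝ (Fv v)) : Submodule ℝ (Cochain Fv) where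
  carrier := {x | ∀ v, x v ∈ W v}
  add_mem' hx hy v := (W v).add_mem (hx v) (hy v)
  zero_mem' v := (W v).zero_mem
  smul_mem' r _ hx v := (W v).smul_mem r (hx v)

/-- Stubborn opinion configurations `C⁰(S) = ⨁ v, S v`. -/
abbrev stubbornSpace (S : ∀ v, Submodule ℝ (Fv v)) : Submodule ℝ (Cochain Fv) :=
  cochainSubspace S

/-- Free opinion configurations `C⁰(Q) = ⨁ v, (S v)ᗮ`. -/
abbrev freeSpace (S : ∀ v, Submodule ℝ (Fv v)) : Submodule ℝ (Cochain Fv) :=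
  cochainSubspace fun v => (S v)ᗮ

/-- The total opinion state `x = ũ + ỹ`. -/
def opinion {S : ∀ v, Submodule ℝ (Fv v)} (u : stubbornSpace S) (y : freeSpace S) :
    Cochain Fv :=
  (u : Cochain Fv) + (y : Cochain Fv)

end Opinions

/-! ### The joint dynamics -/

section Dynamics

variable {V : Type*} [Fintype V] {G : SimpleGraph V} [Fintype G.edgeSet]
  {Fv : V → Type*} [∀ v, NormedAddCommGroup (Fv v)] [∀ v, InnerProductSpace ℝ (Fv v)]
  [∀ v, FiniteDimensional ℝ (Fv v)]
  {Fe : G.edgeSet → Type*} [∀ e, NormedAddCommGroup (Fe e)]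
  [∀ e, InnerProductSpace ℝ (Fe e)] [∀ e, FiniteDimensional ℝ (Fe e)]
  {S : ∀ v, Submodule ℝ (Fv v)}

/-- The operator `x xᵀ : z ↦ ⟪x, z⟫ x`. -/
def outerSelf (x : Cochain Fv) : Cochain Fv →ₗ[ℝ] Cochain Fv :=
  (innerₛₗ ℝ x).smulRight x

/-- `P_Q (δᵀ δ x)`, with `P_Q` the orthogonal projection onto the free opinions. -/
def opinionGrad (u : stubbornSpace S) (y : freeSpace S)
    (δ : FrobHom (Cochain Fv) (Cochain Fe)) : freeSpace S :=
  (freeSpace S).orthogonalProjectionOnto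
    (LinearMap.adjoint (FrobHom.toLin δ) (FrobHom.toLin δ (opinion u y)))

/-- `Π_M (δ x xᵀ)`, with `Π_M` the Frobenius-orthogonal projection onto `M`. -/
def structureGrad (o : EdgeOrientation G) (I : Set (Incidence G)) (u : stubbornSpace S)
    (y : freeSpace S) (δ : FrobHom (Cochain Fv) (Cochain Fe)) :
    FrobHom (Cochain Fv) (Cochain Fe) :=
  (velocitySpace Fv Fe o I).starProjection
    (FrobHom.ofLin (FrobHom.toLin δ ∘ₗ outerSelf (opinion u y)))

/-- The disagreement energy `Ψ (y, δ) = ½ ‖δ x‖²`. -/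
def disagreement (u : stubbornSpace S) (y : freeSpace S)
    (δ : FrobHom (Cochain Fv) (Cochain Fe)) : ℝ :=
  1 / 2 * ‖FrobHom.toLin δ (opinion u y)‖ ^ 2

/-- Time intervals `[0, T)`, `[0, T]` or `[0, ∞)` on which solutions are considered. -/
structure IsTimeInterval (J : Set ℝ) : Prop where
  ordConnected : J.OrdConnected
  zero_mem : (0 : ℝ) ∈ J
  nonneg : J ⊆ Ici 0

/-- `(y, δ)` solves, on the time set `J`, the constrained joint dynamics
`dy/dt = -α P_Q (δᵀ δ x)`, `dδ/dt = -β Π_M (δ x xᵀ)` (one-sided derivatives at endpoints),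
where `δ t` is at all times the coboundary operator of a sheaf with the given stalks. -/
structure IsJointSolution (o : EdgeOrientation G) (I : Set (Incidence G))
    (u : stubbornSpace S) (α β : ℝ) (J : Set ℝ) (y : ℝ → freeSpace S)
    (δ : ℝ → FrobHom (Cochain Fv) (Cochain Fe)) : Prop where
  isCoboundary : ∀ t ∈ J, δ t ∈ coboundarySpace Fv Fe o
  opinion_deriv : ∀ t ∈ J, HasDerivWithinAt y (-(α • opinionGrad u (y t) (δ t))) J t
  structure_deriv : ∀ t ∈ J,
    HasDerivWithinAt δ (-(β • structureGrad o I u (y t) (δ t))) J t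

/-- The equilibria of the joint dynamics with stubborn opinions `u`, in the state space of free
opinions and sheaf structures whose non-adapting restriction maps are those of `δ₀`. -/
def equilibria (o : EdgeOrientation G) (I : Set (Incidence G)) (u : stubbornSpace S) (α β : ℝ)
    (δ₀ : FrobHom (Cochain Fv) (Cochain Fe)) :
    Set (freeSpace S × FrobHom (Cochain Fv) (Cochain Fe)) :=
  {z | z.2 ∈ coboundarySpace Fv Fe o ∧ z.2 - δ₀ ∈ velocitySpace Fv Fe o I ∧
    -(α • opinionGrad u z.1 z.2) = 0 ∧ -(β • structureGrad o I u z.1 z.2) = 0}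

end Dynamics

end

/-! The dynamics is a gradient flow for `disagreement`, restricted to admissible directions. The
gradient of ½‖δx‖² in x is δᵀδx and in δ, for the Frobenius product, it is δxxᵀ; orthogonal
projection onto free opinions and onto M gives dΨ/dt = -α‖P_Q(δᵀδx)‖² - β‖Π_M(δxxᵀ)‖² ≤ 0
(`IsJointSolution.hasDerivWithinAt_disagreement`).

For the norm, d/dt ‖δ‖² = -2β⟪δ, Π_M(δxxᵀ)⟫. Coboundaries supported on disjoint sets of incidences
are Frobenius-orthogonal, so Π_M merely erases the non-adapting restriction maps of a coboundary
(`starProjection_velocitySpace_coboundary`). The pairing thus becomes ∑ₑ ⟪(δ'x)ₑ, (δx)ₑ⟫, with δ'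
the truncated coboundary. A Type S edge contributes ‖(δx)ₑ‖² or 0. At a Type A edge only one term
survives in (δ'x)ₑ, and if the frozen side is the same vector twice as long, the contribution is
negative (`exists_inner_structureGrad_neg`). Local existence of solutions from such data then makes
‖δ‖ fail to be nonincreasing.

Convergence is a LaSalle argument: a precompact trajectory of a continuous field is Lipschitz, so
the energy decay rate vanishes at each of its limit points (`decay_eq_zero_of_tendsto`). That rate
is zero only where both gradients vanish, so limit points are themselves equilibria and no
invariance of the limit set is needed. -/

noncomputable section

/-! ### Frobenius pairing with rank-one maps; continuous bilinear operations. -/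

namespace FrobHom

variable {E F : Type*} [NormedAddCommGroup E] [InnerProductSpace ℝ E]
  [NormedAddCommGroup F] [InnerProductSpace ℝ F] [FiniteDimensional ℝ E] [FiniteDimensional ℝ F]

theorem inner_eq_sum {ι : Type*} [Fintype ι] (b : OrthonormalBasis ι ℝ E) (A B : FrobHom E F) :
    ⟪A, B⟫_ℝ = ∑ i, ⟪toLin A (b i), toLin B (b i)⟫_ℝ :=
  frobInner_eq_sum b A B

/-- `⟪A, w xᵀ⟫ = ⟪A x, w⟫`. -/
theorem inner_ofLin_smulRight (A : FrobHom E F) (x : E) (w : F) :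
    ⟪A, ofLin ((innerₛₗ ℝ x).smulRight w)⟫_ℝ = ⟪toLin A x, w⟫_ℝ := by
  let b := stdOrthonormalBasis ℝ E
  rw [inner_eq_sum b]
  conv_rhs => rw [← b.sum_repr' x, map_sum, sum_inner]
  refine Finset.sum_congr rfl fun i _ => ?_
  rw [map_smul, real_inner_smul_left]
  change ⟪toLin A (b i), ⟪x, b i⟫_ℝ • w⟫_ℝ = _
  rw [real_inner_smul_right, real_inner_comm]

/-- Evaluation `(A, x) ↦ A x` as a continuous bilinear map. -/
def evalCLM : FrobHom E F →L[ℝ] E →L[ℝ] F :=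
  LinearMap.toContinuousLinearMap
    ((LinearMap.toContinuousLinearMap : (E →ₗ[ℝ] F) ≃ₗ[ℝ] (E →L[ℝ] F)).toLinearMap ∘ₗ
      (toLin (E := E) (F := F)).toLinearMap)

/-- The adjoint, as a continuous bilinear map `(A, w) ↦ Aᵀ w`. -/
def adjCLM : FrobHom E F →L[ℝ] F →L[ℝ] E :=
  LinearMap.toContinuousLinearMap
    ({ toFun := fun A => LinearMap.toContinuousLinearMap (LinearMap.adjoint (toLin A))
       map_add' := fun A B => by simp only [map_add]
       map_smul' := fun r A => by
        have : LinearMap.adjoint (r • toLin A) = r • LinearMap.adjoint (toLin A) := by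
          simp only [map_smulₛₗ, conj_trivial]
        rw [map_smul, this, map_smul, RingHom.id_apply] } :
      FrobHom E F →ₗ[ℝ] F →L[ℝ] E)

/-- `(x, w) ↦ w xᵀ` as a continuous bilinear map. -/
def rankOneCLM : E →L[ℝ] F →L[ℝ] FrobHom E F :=
  LinearMap.toContinuousLinearMap
    ((LinearMap.toContinuousLinearMap :
        (F →ₗ[ℝ] FrobHom E F) ≃ₗ[ℝ] (F →L[ℝ] FrobHom E F)).toLinearMap ∘ₗ
      LinearMap.mk₂ ℝ (fun (x : E) (w : F) => ofLin ((innerₛₗ ℝ x).smulRight w))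
        (fun x x' w => by
          rw [← map_add]; congr 1; ext z
          simp [add_smul])
        (fun c x w => by
          rw [← map_smul]; congr 1; ext z
          simp [mul_smul])
        (fun x w w' => by
          rw [← map_add]; congr 1; ext z
          simp)
        (fun c x w => by
          rw [← map_smul]; congr 1; ext z
          simp [smul_comm c]))

end FrobHom

/-! ### Coboundaries and the projection onto `velocitySpace`. -/

section Sheaf

variable {V : Type*} {G : SimpleGraph V}

theorem EdgeOrientation.src_ne_tgt (o : EdgeOrientation G) (e : G.edgeSet) :
    o.src e ≠ o.tgt e := by
  have h := e.2
  rw [← o.ends e, SimpleGraph.mem_edgeSet] at h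
  exact h.ne

theorem EdgeOrientation.eq_srcInc_or_eq_tgtInc (o : EdgeOrientation G) (p : Incidence G) :
    p = o.srcInc p.e ∨ p = o.tgtInc p.e := by
  obtain ⟨v, e, h⟩ := p
  have h' := h
  rw [← o.ends e, Sym2.mem_iff] at h'
  rcases h' with rfl | rfl
  · exact Or.inl rfl
  · exact Or.inr rfl

section AdaptingPart

variable {Fv : V → Type*} [∀ v, NormedAddCommGroup (Fv v)] [∀ v, InnerProductSpace ℝ (Fv v)]
  {Fe : G.edgeSet → Type*} [∀ e, NormedAddCommGroup (Fe e)]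
  [∀ e, InnerProductSpace ℝ (Fe e)]

open Classical in
/-- Discard the non-adapting restriction maps. -/
def adaptingPart (I : Set (Incidence G)) (ρ : RestrictionMaps Fv Fe) : RestrictionMaps Fv Fe :=
  fun p => if p ∈ I then ρ p else 0

theorem adaptingPart_of_mem {I : Set (Incidence G)} (ρ : RestrictionMaps Fv Fe) {p : Incidence G}
    (hp : p ∈ I) : adaptingPart I ρ p = ρ p := if_pos hp

theorem adaptingPart_of_notMem {I : Set (Incidence G)} (ρ : RestrictionMaps Fv Fe)
    {p : Incidence G} (hp : p ∉ I) : adaptingPart I ρ p = 0 := if_neg hp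

theorem srcMap_adaptingPart_of_mem (o : EdgeOrientation G) {I : Set (Incidence G)}
    (ρ : RestrictionMaps Fv Fe) {e : G.edgeSet} (h : o.srcInc e ∈ I) :
    srcMap o (adaptingPart I ρ) e = srcMap o ρ e := if_pos h

theorem srcMap_adaptingPart_of_notMem (o : EdgeOrientation G) {I : Set (Incidence G)}
    (ρ : RestrictionMaps Fv Fe) {e : G.edgeSet} (h : o.srcInc e ∉ I) :
    srcMap o (adaptingPart I ρ) e = 0 := if_neg h

theorem tgtMap_adaptingPart_of_mem (o : EdgeOrientation G) {I : Set (Incidence G)}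
    (ρ : RestrictionMaps Fv Fe) {e : G.edgeSet} (h : o.tgtInc e ∈ I) :
    tgtMap o (adaptingPart I ρ) e = tgtMap o ρ e := if_pos h

theorem tgtMap_adaptingPart_of_notMem (o : EdgeOrientation G) {I : Set (Incidence G)}
    (ρ : RestrictionMaps Fv Fe) {e : G.edgeSet} (h : o.tgtInc e ∉ I) :
    tgtMap o (adaptingPart I ρ) e = 0 := if_neg h

end AdaptingPart

variable [Fintype V] [Fintype G.edgeSet]
  {Fv : V → Type*} [∀ v, NormedAddCommGroup (Fv v)] [∀ v, InnerProductSpace ℝ (Fv v)]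
  {Fe : G.edgeSet → Type*} [∀ e, NormedAddCommGroup (Fe e)]
  [∀ e, InnerProductSpace ℝ (Fe e)]

theorem toLin_coboundary_apply (o : EdgeOrientation G) (ρ : RestrictionMaps Fv Fe)
    (x : Cochain Fv) (e : G.edgeSet) :
    FrobHom.toLin (coboundary o ρ) x e =
      tgtMap o ρ e (x (o.tgt e)) - srcMap o ρ e (x (o.src e)) := rfl

theorem mem_velocitySpace {o : EdgeOrientation G} {I : Set (Incidence G)}
    {A : FrobHom (Cochain Fv) (Cochain Fe)} :
    A ∈ velocitySpace Fv Fe o I ↔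
      ∃ ρ : RestrictionMaps Fv Fe, (∀ p ∉ I, ρ p = 0) ∧ coboundary o ρ = A := by
  simp only [velocitySpace, Submodule.mem_map, Submodule.mem_iInf, LinearMap.mem_ker,
    LinearMap.proj_apply, mem_compl_iff]

theorem velocitySpace_le_coboundarySpace (o : EdgeOrientation G) (I : Set (Incidence G)) :
    velocitySpace Fv Fe o I ≤ coboundarySpace Fv Fe o := by
  intro A hA
  obtain ⟨ρ, -, rfl⟩ := mem_velocitySpace.1 hA
  exact LinearMap.mem_range_self _ _

variable [∀ v, FiniteDimensional ℝ (Fv v)] [∀ e, FiniteDimensional ℝ (Fe e)]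

/-- Sheaves supported on disjoint sets of incidences have Frobenius-orthogonal coboundaries. -/
theorem inner_coboundary_eq_zero (o : EdgeOrientation G) {ρ σ : RestrictionMaps Fv Fe}
    (h : ∀ p, ρ p = 0 ∨ σ p = 0) : ⟪coboundary o ρ, coboundary o σ⟫_ℝ = 0 := by
  classical
  -- Each vector of this basis is supported at a single vertex. Since an edge has distinct
  -- endpoints, at most one of its two restriction maps sees the vector, and no cross terms appear.
  rw [FrobHom.inner_eq_sum (Pi.orthonormalBasis fun v => stdOrthonormalBasis ℝ (Fv v))]
  refine Finset.sum_eq_zero fun i _ => ?_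
  rw [PiLp.inner_apply]
  refine Finset.sum_eq_zero fun e _ => ?_
  rw [toLin_coboundary_apply, toLin_coboundary_apply, Pi.orthonormalBasis_apply]
  have key : ∀ p, ∀ z, ⟪ρ p z, σ p z⟫_ℝ = 0 := fun p z => by
    rcases h p with h | h <;> simp [h]
  by_cases hi : i.1 = o.tgt e
  · have : (PiLp.single 2 i.1 (stdOrthonormalBasis ℝ (Fv i.1) i.2) : Cochain Fv) (o.src e) = 0 := by
      simp [hi, o.src_ne_tgt e]
    rw [this, map_zero, map_zero, sub_zero, sub_zero]
    exact key (o.tgtInc e) _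
  · have : (PiLp.single 2 i.1 (stdOrthonormalBasis ℝ (Fv i.1) i.2) : Cochain Fv) (o.tgt e) = 0 := by
      simp [Ne.symm hi]
    rw [this, map_zero, map_zero, zero_sub, zero_sub, inner_neg_neg]
    exact key (o.srcInc e) _

/-- The discarded part is supported off `I` and every element of M on `I`, so the two are orthogonal
by `inner_coboundary_eq_zero`. -/
theorem starProjection_velocitySpace_coboundary (o : EdgeOrientation G) (I : Set (Incidence G))
    (ρ : RestrictionMaps Fv Fe) :
    (velocitySpace Fv Fe o I).starProjection (coboundary o ρ) =
      coboundary o (adaptingPart I ρ) := by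
  refine Submodule.eq_starProjection_of_mem_orthogonal
    (mem_velocitySpace.2 ⟨_, fun p hp => adaptingPart_of_notMem ρ hp, rfl⟩) ?_
  rw [← map_sub, Submodule.mem_orthogonal]
  intro A hA
  obtain ⟨σ, hσ, rfl⟩ := mem_velocitySpace.1 hA
  refine inner_coboundary_eq_zero o fun p => ?_
  by_cases hp : p ∈ I
  · right
    rw [Pi.sub_apply, adaptingPart_of_mem ρ hp, sub_self]
  · exact Or.inl (hσ p hp)

end Sheaf

section Opinions

variable {V : Type*} [Fintype V] {Fv : V → Type*} [∀ v, NormedAddCommGroup (Fv v)]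
  [∀ v, InnerProductSpace ℝ (Fv v)]

theorem comp_outerSelf {F : Type*} [AddCommGroup F] [Module ℝ F] (A : Cochain Fv →ₗ[ℝ] F)
    (x : Cochain Fv) : A ∘ₗ outerSelf x = (innerₛₗ ℝ x).smulRight (A x) := by
  ext z : 1
  simp [outerSelf]

end Opinions

/-! ### The two gradients and the growth rate of the Frobenius norm. -/

section Dynamics

variable {V : Type*} [Fintype V] {G : SimpleGraph V} [Fintype G.edgeSet]
  {Fv : V → Type*} [∀ v, NormedAddCommGroup (Fv v)] [∀ v, InnerProductSpace ℝ (Fv v)]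
  [∀ v, FiniteDimensional ℝ (Fv v)]
  {Fe : G.edgeSet → Type*} [∀ e, NormedAddCommGroup (Fe e)]
  [∀ e, InnerProductSpace ℝ (Fe e)] [∀ e, FiniteDimensional ℝ (Fe e)]
  {S : ∀ v, Submodule ℝ (Fv v)}

/-- This form, built from continuous linear and bilinear maps, makes smoothness in (y, δ) immediate.
-/
theorem structureGrad_eq (o : EdgeOrientation G) (I : Set (Incidence G)) (u : stubbornSpace S)
    (y : freeSpace S) (δ : FrobHom (Cochain Fv) (Cochain Fe)) :
    structureGrad o I u y δ = (velocitySpace Fv Fe o I).starProjection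
      (FrobHom.rankOneCLM (opinion u y) (FrobHom.evalCLM δ (opinion u y))) := by
  rw [structureGrad, comp_outerSelf]; rfl

theorem opinionGrad_eq (u : stubbornSpace S) (y : freeSpace S)
    (δ : FrobHom (Cochain Fv) (Cochain Fe)) :
    opinionGrad u y δ = (freeSpace S).orthogonalProjectionOnto
      (FrobHom.adjCLM δ (FrobHom.evalCLM δ (opinion u y))) := rfl

theorem structureGrad_mem (o : EdgeOrientation G) (I : Set (Incidence G)) (u : stubbornSpace S)
    (y : freeSpace S) (δ : FrobHom (Cochain Fv) (Cochain Fe)) :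
    structureGrad o I u y δ ∈ velocitySpace Fv Fe o I :=
  Submodule.starProjection_apply_mem _ _

/-- The projection is self-adjoint and δxxᵀ is the rank-one map (δx)xᵀ. Used twice: A = δ gives the
growth of the norm, and A = `structureGrad` itself gives the dissipation of energy. -/
theorem inner_structureGrad (o : EdgeOrientation G) (I : Set (Incidence G)) (u : stubbornSpace S)
    (y : freeSpace S) (δ A : FrobHom (Cochain Fv) (Cochain Fe)) :
    ⟪A, structureGrad o I u y δ⟫_ℝ =
      ⟪FrobHom.toLin ((velocitySpace Fv Fe o I).starProjection A) (opinion u y),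
        FrobHom.toLin δ (opinion u y)⟫_ℝ := by
  rw [structureGrad, ← Submodule.inner_starProjection_left_eq_right, comp_outerSelf,
    FrobHom.inner_ofLin_smulRight]

theorem inner_opinionGrad (u : stubbornSpace S) (y z : freeSpace S)
    (δ : FrobHom (Cochain Fv) (Cochain Fe)) :
    ⟪z, opinionGrad u y δ⟫_ℝ =
      ⟪FrobHom.toLin δ (z : Cochain Fv), FrobHom.toLin δ (opinion u y)⟫_ℝ := by
  rw [opinionGrad, Submodule.inner_orthogonalProjectionOnto_eq_of_mem_left,
    LinearMap.adjoint_inner_right]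

/-- For coboundaries, the growth rate of the Frobenius norm, up to the factor `-β`. -/
theorem inner_coboundary_structureGrad (o : EdgeOrientation G) (I : Set (Incidence G))
    (u : stubbornSpace S) (y : freeSpace S) (ρ : RestrictionMaps Fv Fe) :
    ⟪coboundary o ρ, structureGrad o I u y (coboundary o ρ)⟫_ℝ =
      ∑ e, ⟪FrobHom.toLin (coboundary o (adaptingPart I ρ)) (opinion u y) e,
        FrobHom.toLin (coboundary o ρ) (opinion u y) e⟫_ℝ := by
  rw [inner_structureGrad, starProjection_velocitySpace_coboundary, PiLp.inner_apply]

/-- On a Type S edge, truncation keeps both restriction maps or neither, so each summand is a square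
or zero. -/
theorem inner_structureGrad_self_nonneg {o : EdgeOrientation G} {I : Set (Incidence G)}
    (hI : ∀ e, IsTypeS I e) (u : stubbornSpace S) (y : freeSpace S)
    {δ : FrobHom (Cochain Fv) (Cochain Fe)} (hδ : δ ∈ coboundarySpace Fv Fe o) :
    0 ≤ ⟪δ, structureGrad o I u y δ⟫_ℝ := by
  obtain ⟨ρ, rfl⟩ := hδ
  rw [inner_coboundary_structureGrad]
  refine Finset.sum_nonneg fun e _ => ?_
  have hiff := hI e (o.srcInc e) (o.tgtInc e) rfl rfl
  rw [toLin_coboundary_apply, toLin_coboundary_apply]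
  by_cases h : o.srcInc e ∈ I
  · rw [srcMap_adaptingPart_of_mem o ρ h, tgtMap_adaptingPart_of_mem o ρ (hiff.1 h)]
    exact real_inner_self_nonneg
  · rw [srcMap_adaptingPart_of_notMem o ρ h,
      tgtMap_adaptingPart_of_notMem o ρ fun h' => h (hiff.2 h')]
    simp

open Classical in
/-- At a Type A edge with nonzero stalk and nonzero opinions at its endpoints, some sheaf has
growing Frobenius norm. -/
theorem exists_inner_structureGrad_neg {o : EdgeOrientation G} {I : Set (Incidence G)}
    {e : G.edgeSet} (he : IsTypeA I e) [Nontrivial (Fe e)] (u : stubbornSpace S) (y : freeSpace S)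
    (hx : ∀ v ∈ (e : Sym2 V), opinion u y v ≠ 0) :
    ∃ δ ∈ coboundarySpace Fv Fe o, ⟪δ, structureGrad o I u y δ⟫_ℝ < 0 := by
  obtain ⟨f, hf⟩ := exists_ne (0 : Fe e)
  set x := opinion u y with hxdef
  let g : ∀ e, Fe e := Pi.single e f
  -- The rank-one maps below send the opinion at an endpoint of `e` to `f` on the adapting side and
  -- to `2 • f` on the frozen side. Edge `e` then contributes ⟪f, f - 2f⟫ = -‖f‖² for either
  -- orientation, and all other edges contribute zero because `g` vanishes there.
  let c : Incidence G → ℝ := fun r => if r ∈ I then 1 else 2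
  let ρ : RestrictionMaps Fv Fe := fun r =>
    (c r * (‖x r.v‖ ^ 2)⁻¹) • (innerₛₗ ℝ (x r.v)).smulRight (g r.e)
  have hg : ∀ e', e' ≠ e → g e' = 0 := fun e' h => Pi.single_eq_of_ne h _
  have hge : g e = f := Pi.single_eq_same _ _
  have hρ : ∀ r : Incidence G, r.e = e → ρ r (x r.v) = c r • g r.e := by
    intro r hr
    have h0 : ‖x r.v‖ ^ 2 ≠ 0 := by
      have := hx r.v (hr ▸ r.inc)
      simpa using this
    change (c r * (‖x r.v‖ ^ 2)⁻¹) • (⟪x r.v, x r.v⟫_ℝ • g r.e) = _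
    rw [real_inner_self_eq_norm_sq, smul_smul, mul_assoc, inv_mul_cancel₀ h0, mul_one]
  refine ⟨coboundary o ρ, LinearMap.mem_range_self _ _, ?_⟩
  rw [inner_coboundary_structureGrad, ← hxdef, Finset.sum_eq_single e]
  · have hs := hρ (o.srcInc e) rfl
    have ht := hρ (o.tgtInc e) rfl
    change srcMap o ρ e (x (o.src e)) = c (o.srcInc e) • g e at hs
    change tgtMap o ρ e (x (o.tgt e)) = c (o.tgtInc e) • g e at ht
    have hfpos : 0 < ⟪f, f⟫_ℝ := real_inner_self_pos.2 hf
    rw [toLin_coboundary_apply, toLin_coboundary_apply]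
    have hcase : (o.srcInc e ∈ I ∧ o.tgtInc e ∉ I) ∨ (o.tgtInc e ∈ I ∧ o.srcInc e ∉ I) := by
      obtain ⟨p, q, hp, hq, hpI, hqI⟩ := he
      have h1 := o.eq_srcInc_or_eq_tgtInc p
      have h2 := o.eq_srcInc_or_eq_tgtInc q
      rw [hp] at h1
      rw [hq] at h2
      rcases h1 with rfl | rfl <;> rcases h2 with rfl | rfl <;> tauto
    rcases hcase with ⟨h1, h2⟩ | ⟨h1, h2⟩
    · rw [srcMap_adaptingPart_of_mem o ρ h1, tgtMap_adaptingPart_of_notMem o ρ h2, hs, ht, hge]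
      simp only [c, if_pos h1, if_neg h2, LinearMap.zero_apply, zero_sub, one_smul]
      rw [inner_neg_left, inner_sub_right, real_inner_smul_right]
      linarith
    · rw [tgtMap_adaptingPart_of_mem o ρ h1, srcMap_adaptingPart_of_notMem o ρ h2, hs, ht, hge]
      simp only [c, if_pos h1, if_neg h2, LinearMap.zero_apply, sub_zero, one_smul]
      rw [inner_sub_right, real_inner_smul_right]
      linarith
  · intro e' _ hne
    have h0 : ∀ r : Incidence G, r.e = e' → ρ r = 0 := by
      rintro r rfl
      simp only [ρ, hg r.e hne]
      ext; simp
    have ht : tgtMap o ρ e' = 0 := h0 (o.tgtInc e') rfl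
    have hs : srcMap o ρ e' = 0 := h0 (o.srcInc e') rfl
    rw [toLin_coboundary_apply _ ρ, ht, hs]
    simp
  · exact fun h => absurd (Finset.mem_univ e) h

end Dynamics

theorem forall_isTypeS_iff {V : Type*} {G : SimpleGraph V} (I : Set (Incidence G)) :
    (∀ e, IsTypeS I e) ↔ typeAEdges I = ∅ := by
  rw [eq_empty_iff_forall_notMem]
  refine forall_congr' fun e => ⟨?_, fun h p q hp hq => ?_⟩
  · rintro h ⟨p, q, hp, hq, hpI, hqI⟩
    exact hqI ((h p q hp hq).1 hpI)
  · by_contra hne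
    by_cases hpI : p ∈ I
    · exact h ⟨p, q, hp, hq, hpI, fun hqI => hne (by tauto)⟩
    · exact h ⟨q, p, hq, hp, by tauto, hpI⟩

/-! ### Monotonicity, invariance and LaSalle's principle -/

theorem Convex.antitoneOn_of_hasDerivWithinAt_nonpos {J : Set ℝ} (hJ : Convex ℝ J) {f f' : ℝ → ℝ}
    (hf : ∀ t ∈ J, HasDerivWithinAt f (f' t) J t) (hf' : ∀ t ∈ J, f' t ≤ 0) : AntitoneOn f J :=
  _root_.antitoneOn_of_hasDerivWithinAt_nonpos hJ (fun t ht => (hf t ht).continuousWithinAt)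
    (fun t ht => (hf t (interior_subset ht)).mono interior_subset)
    fun t ht => hf' t (interior_subset ht)

/-- The component of `f` in `Kᗮ` has zero derivative, hence is constant. Applied with `K =
velocitySpace`, this says that the dynamics never changes the non-adapting maps. -/
theorem Submodule.sub_mem_of_hasDerivWithinAt {E : Type*} [NormedAddCommGroup E]
    [InnerProductSpace ℝ E] [FiniteDimensional ℝ E] {K : Submodule ℝ E} {J : Set ℝ}
    (hJ : Convex ℝ J) {f f' : ℝ → E} (hf : ∀ t ∈ J, HasDerivWithinAt f (f' t) J t)
    (hK : ∀ t ∈ J, f' t ∈ K) {s t : ℝ} (hs : s ∈ J) (ht : t ∈ J) : f t - f s ∈ K := by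
  have h := hJ.norm_image_sub_le_of_norm_hasDerivWithin_le (C := 0)
    (f := fun t => Kᗮ.starProjection (f t)) (f' := fun t => Kᗮ.starProjection (f' t))
    (fun t ht => Kᗮ.starProjection.hasFDerivAt.comp_hasDerivWithinAt t (hf t ht))
    (fun t ht => by
      rw [Submodule.starProjection_orthogonal_val,
        Submodule.starProjection_eq_self_iff.2 (hK t ht), sub_self, norm_zero]) hs ht
  rw [zero_mul, norm_le_zero_iff, ← map_sub, Submodule.starProjection_orthogonal_val,
    sub_eq_zero] at h
  exact Submodule.starProjection_eq_self_iff.1 h.symm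

section LaSalle

variable {E : Type*} [NormedAddCommGroup E] {z : ℝ → E} {ψ D : E → ℝ}

/-- The decay rate of a Lyapunov function vanishes at every limit point of a Lipschitz
trajectory. -/
theorem decay_eq_zero_of_tendsto {L : ℝ} (hL : 0 < L)
    (hz : ∀ s ∈ Ici (0 : ℝ), ∀ t ∈ Ici (0 : ℝ), ‖z t - z s‖ ≤ L * ‖t - s‖)
    (hψ : Continuous ψ) (hD : Continuous D) (hD0 : ∀ w, 0 ≤ D w)
    (hdec : ∀ t ∈ Ici (0 : ℝ), HasDerivWithinAt (fun t => ψ (z t)) (-D (z t)) (Ici 0) t)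
    {s : ℕ → ℝ} (hs : Tendsto s atTop atTop) {w : E} (hw : Tendsto (z ∘ s) atTop (𝓝 w)) :
    D w = 0 := by
  by_contra hne
  have hpos : 0 < D w := lt_of_le_of_ne (hD0 w) (Ne.symm hne)
  have hanti : AntitoneOn (fun t => ψ (z t)) (Ici 0) :=
    (convex_Ici 0).antitoneOn_of_hasDerivWithinAt_nonpos hdec fun t _ => neg_nonpos.2 (hD0 _)
  have hψw : Tendsto (fun n => ψ (z (s n))) atTop (𝓝 (ψ w)) := (hψ.tendsto w).comp hw
  have hlower : ∀ t ∈ Ici (0 : ℝ), ψ w ≤ ψ (z t) := fun t ht =>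
    le_of_tendsto hψw ((hs.eventually_ge_atTop t).mono fun n hn =>
      hanti ht (mem_Ici.2 (le_trans ht hn)) hn)
  obtain ⟨r, hr, hball⟩ := Metric.eventually_nhds_iff.1
    (hD.continuousAt.eventually (lt_mem_nhds (half_lt_self hpos)))
  -- Within distance `r` of `w` the decay rate exceeds `η`. A trajectory of speed at most `L`
  -- starting within `r / 2` of `w` stays in that ball for time `τ = r / (2 * L)`, so ψ loses at
  -- least `η * τ`. As ψ never falls below `ψ w`, it must start at least `η * τ` above it,
  -- contradicting convergence to `ψ w`.
  set η := D w / 2 with hη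
  have hηpos : 0 < η := half_pos hpos
  set τ := r / (2 * L) with hτ
  have hτpos : 0 < τ := by positivity
  have hdrop : ∀ᶠ n in atTop, ψ w + η * τ ≤ ψ (z (s n)) := by
    filter_upwards [hs.eventually_ge_atTop 0,
      hw.eventually (Metric.ball_mem_nhds w (half_pos hr))] with n hn0 hnw
    have hsub : Icc (s n) (s n + τ) ⊆ Ici 0 := fun t ht => le_trans hn0 ht.1
    have hanti' : AntitoneOn (fun t => ψ (z t) + η * t) (Icc (s n) (s n + τ)) := by
      refine (convex_Icc _ _).antitoneOn_of_hasDerivWithinAt_nonpos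
        (f' := fun t => -D (z t) + η * 1)
        (fun t ht => ((hdec t (hsub ht)).mono hsub).add ((hasDerivWithinAt_id _ _).const_mul η))
        fun t ht => ?_
      have h1 : ‖z t - z (s n)‖ ≤ r / 2 := by
        refine (hz _ hn0 _ (hsub ht)).trans ?_
        rw [Real.norm_of_nonneg (sub_nonneg.2 ht.1)]
        calc L * (t - s n) ≤ L * τ := by gcongr; linarith [ht.2]
          _ = r / 2 := by rw [hτ]; field_simp
      have h2 : dist (z t) w < r := by
        have h3 : dist (z (s n)) w < r / 2 := hnw
        have := dist_triangle (z t) (z (s n)) w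
        rw [dist_eq_norm (z t) (z (s n))] at this
        linarith
      have := hball h2
      linarith
    have h := hanti' (left_mem_Icc.2 (by linarith)) (right_mem_Icc.2 (by linarith))
      (by linarith : s n ≤ s n + τ)
    have h' := hlower (s n + τ) (hsub (right_mem_Icc.2 (by linarith)))
    simp only at h
    nlinarith
  have := ge_of_tendsto hψw hdrop
  nlinarith [mul_pos hηpos hτpos]

variable [NormedSpace ℝ E]

/-- LaSalle's invariance principle for a precompact trajectory in a closed set `A`, on which the
decay rate `D` of the Lyapunov function `ψ` vanishes only at points of `Z`. -/
theorem tendsto_infEDist_of_decay {X : E → E} (hX : Continuous X)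
    (hz : ∀ t ∈ Ici (0 : ℝ), HasDerivWithinAt z (X (z t)) (Ici 0) t)
    (hψ : Continuous ψ) (hD : Continuous D) (hD0 : ∀ w, 0 ≤ D w)
    (hdec : ∀ t ∈ Ici (0 : ℝ), HasDerivWithinAt (fun t => ψ (z t)) (-D (z t)) (Ici 0) t)
    (hcpt : IsCompact (closure (z '' Ici 0))) {A Z : Set E} (hA : IsClosed A)
    (hzA : ∀ t ∈ Ici (0 : ℝ), z t ∈ A) (hZ : ∀ w ∈ A, D w = 0 → w ∈ Z) :
    Tendsto (fun t => Metric.infEDist (z t) Z) atTop (𝓝 0) := by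
  obtain ⟨C, hC⟩ := hcpt.exists_bound_of_continuousOn hX.continuousOn
  -- The bound `C` need not be positive; `|C| + 1` is a strictly positive Lipschitz constant.
  have hlip : ∀ s ∈ Ici (0 : ℝ), ∀ t ∈ Ici (0 : ℝ), ‖z t - z s‖ ≤ (|C| + 1) * ‖t - s‖ :=
    fun s hs t ht => (convex_Ici 0).norm_image_sub_le_of_norm_hasDerivWithin_le hz
      (fun t ht => (hC _ (subset_closure (mem_image_of_mem z ht))).trans
        (by linarith [le_abs_self C])) hs ht
  rw [ENNReal.tendsto_nhds_zero]
  by_contra! hcon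
  obtain ⟨ε, hε, hfreq⟩ := hcon
  -- Times tending to infinity at which the trajectory is farther than `ε` from `Z`; by compactness
  -- a subsequence converges, and its limit turns out to lie in `Z`.
  obtain ⟨s, hs, hsε⟩ := exists_seq_forall_of_frequently
    (hfreq.and_eventually (eventually_ge_atTop (0 : ℝ)))
  obtain ⟨w, -, φ, hφ, hw⟩ := hcpt.tendsto_subseq
    (x := z ∘ s) fun n => subset_closure (mem_image_of_mem z (hsε n).2)
  have hDw : D w = 0 := decay_eq_zero_of_tendsto (by positivity : 0 < |C| + 1) hlip hψ hD hD0 hdec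
    (hs.comp hφ.tendsto_atTop) hw
  have hwA : w ∈ A := hA.mem_of_tendsto hw (Eventually.of_forall fun n => hzA _ (hsε _).2)
  have hlim : Tendsto (fun n => edist (z (s (φ n))) w) atTop (𝓝 0) := by
    simpa using Tendsto.edist hw (tendsto_const_nhds (x := w))
  obtain ⟨n, hn⟩ := ((ENNReal.tendsto_nhds_zero.1 hlim) ε hε).exists
  exact (hsε (φ n)).1.not_ge ((Metric.infEDist_le_edist_of_mem (hZ w hwA hDw)).trans hn)

end LaSalle

/-! ### The joint dynamics -/

theorem FrobHom.hasDerivWithinAt_half_norm_sq {E F : Type*} [NormedAddCommGroup E]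
    [InnerProductSpace ℝ E] [NormedAddCommGroup F] [InnerProductSpace ℝ F]
    [FiniteDimensional ℝ E] [FiniteDimensional ℝ F] {A : ℝ → FrobHom E F} {A' : FrobHom E F}
    {x : ℝ → E} {x' : E} {J : Set ℝ} {t : ℝ} (hA : HasDerivWithinAt A A' J t)
    (hx : HasDerivWithinAt x x' J t) :
    HasDerivWithinAt (fun t => 1 / 2 * ‖toLin (A t) (x t)‖ ^ 2)
      (⟪toLin (A t) (x t), toLin A' (x t)⟫_ℝ + ⟪toLin (A t) (x t), toLin (A t) x'⟫_ℝ) J t := by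
  have hA' : HasDerivWithinAt (fun t => evalCLM (E := E) (F := F) (A t))
      (evalCLM (E := E) (F := F) A') J t :=
    (evalCLM (E := E) (F := F)).hasFDerivAt.comp_hasDerivWithinAt t hA
  have hev := hA'.clm_apply hx
  refine (hev.norm_sq.const_mul (1 / 2 : ℝ)).congr_deriv ?_
  rw [inner_add_right, ← mul_assoc, one_div_mul_cancel two_ne_zero, one_mul]
  rfl

section Opinions

variable {V : Type*} {Fv : V → Type*} [∀ v, NormedAddCommGroup (Fv v)]
  [∀ v, InnerProductSpace ℝ (Fv v)] {S : ∀ v, Submodule ℝ (Fv v)}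

open Classical in
-- Free opinions form a direct sum over the vertices, so choices made separately at each vertex can
-- be glued.
theorem exists_opinion_ne_zero {s : Set V} (u : stubbornSpace S)
    (h : ∀ v ∈ s, ∃ y : freeSpace S, opinion u y v ≠ 0) :
    ∃ y : freeSpace S, ∀ v ∈ s, opinion u y v ≠ 0 := by
  choose y hy using h
  refine ⟨⟨WithLp.toLp 2 fun v => if hv : v ∈ s then (y v hv : Cochain Fv) v else 0,
    fun v => ?_⟩, fun v hv => ?_⟩
  · by_cases hv : v ∈ s
    · simpa [hv] using (y v hv).2 v
    · simp [hv]
  · simpa [opinion, hv] using hy v hv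

/-- Once the stubborn opinions may vary too, no total state is excluded; only nonzero vertex stalks
are then needed for nonvanishing opinions. -/
theorem exists_opinion_eq [∀ v, FiniteDimensional ℝ (Fv v)] (S : ∀ v, Submodule ℝ (Fv v))
    (x : Cochain Fv) : ∃ (u : stubbornSpace S) (y : freeSpace S), opinion u y = x := by
  refine ⟨⟨WithLp.toLp 2 fun v => (S v).starProjection (x v),
      fun v => Submodule.starProjection_apply_mem _ _⟩,
    ⟨WithLp.toLp 2 fun v => x v - (S v).starProjection (x v),
      fun v => Submodule.sub_starProjection_mem_orthogonal _⟩, ?_⟩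
  ext v
  simp [opinion]

end Opinions

section Dynamics

variable {V : Type*} [Fintype V] {G : SimpleGraph V} [Fintype G.edgeSet]
  {Fv : V → Type*} [∀ v, NormedAddCommGroup (Fv v)] [∀ v, InnerProductSpace ℝ (Fv v)]
  [∀ v, FiniteDimensional ℝ (Fv v)]
  {Fe : G.edgeSet → Type*} [∀ e, NormedAddCommGroup (Fe e)]
  [∀ e, InnerProductSpace ℝ (Fe e)] [∀ e, FiniteDimensional ℝ (Fe e)]
  {S : ∀ v, Submodule ℝ (Fv v)}

/-! ### Smoothness of the vector field and the energy decay rate. -/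

theorem contDiff_opinion (u : stubbornSpace S) :
    ContDiff ℝ 1 (fun w : freeSpace S × FrobHom (Cochain Fv) (Cochain Fe) => opinion u w.1) :=
  contDiff_const.add ((freeSpace S).subtypeL.contDiff.comp contDiff_fst)

theorem contDiff_toLin_opinion (u : stubbornSpace S) :
    ContDiff ℝ 1 (fun w : freeSpace S × FrobHom (Cochain Fv) (Cochain Fe) =>
      FrobHom.evalCLM w.2 (opinion u w.1)) :=
  (FrobHom.evalCLM.contDiff.comp contDiff_snd).clm_apply (contDiff_opinion u)

theorem contDiff_opinionGrad (u : stubbornSpace S) :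
    ContDiff ℝ 1 (fun w : freeSpace S × FrobHom (Cochain Fv) (Cochain Fe) =>
      opinionGrad u w.1 w.2) := by
  simp only [opinionGrad_eq]
  exact (freeSpace S).orthogonalProjectionOnto.contDiff.comp
    ((FrobHom.adjCLM.contDiff.comp contDiff_snd).clm_apply (contDiff_toLin_opinion u))

theorem contDiff_structureGrad (o : EdgeOrientation G) (I : Set (Incidence G))
    (u : stubbornSpace S) :
    ContDiff ℝ 1 (fun w : freeSpace S × FrobHom (Cochain Fv) (Cochain Fe) =>
      structureGrad o I u w.1 w.2) := by
  simp only [structureGrad_eq]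
  exact (velocitySpace Fv Fe o I).starProjection.contDiff.comp
    (((FrobHom.rankOneCLM (E := Cochain Fv) (F := Cochain Fe)).contDiff.comp
      (contDiff_opinion u)).clm_apply (contDiff_toLin_opinion u))

theorem continuous_disagreement (u : stubbornSpace S) :
    Continuous (fun w : freeSpace S × FrobHom (Cochain Fv) (Cochain Fe) =>
      disagreement u w.1 w.2) :=
  continuous_const.mul ((contDiff_toLin_opinion u).continuous.norm.pow 2)

/-- The right-hand side of the joint dynamics. -/
def jointField (o : EdgeOrientation G) (I : Set (Incidence G)) (u : stubbornSpace S) (α β : ℝ)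
    (w : freeSpace S × FrobHom (Cochain Fv) (Cochain Fe)) :
    freeSpace S × FrobHom (Cochain Fv) (Cochain Fe) :=
  (-(α • opinionGrad u w.1 w.2), -(β • structureGrad o I u w.1 w.2))

theorem contDiff_jointField (o : EdgeOrientation G) (I : Set (Incidence G)) (u : stubbornSpace S)
    (α β : ℝ) : ContDiff ℝ 1 (jointField (Fe := Fe) o I u α β) :=
  (((contDiff_opinionGrad (Fe := Fe) u).const_smul α).neg).prodMk
    (((contDiff_structureGrad (Fe := Fe) o I u).const_smul β).neg)

/-- The decay rate of the disagreement energy. -/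
def energyDecay (o : EdgeOrientation G) (I : Set (Incidence G)) (u : stubbornSpace S) (α β : ℝ)
    (w : freeSpace S × FrobHom (Cochain Fv) (Cochain Fe)) : ℝ :=
  α * ‖opinionGrad u w.1 w.2‖ ^ 2 + β * ‖structureGrad o I u w.1 w.2‖ ^ 2

theorem continuous_energyDecay (o : EdgeOrientation G) (I : Set (Incidence G))
    (u : stubbornSpace S) (α β : ℝ) : Continuous (energyDecay (Fe := Fe) o I u α β) :=
  (continuous_const.mul ((contDiff_opinionGrad u).continuous.norm.pow 2)).add
    (continuous_const.mul ((contDiff_structureGrad o I u).continuous.norm.pow 2))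

theorem energyDecay_nonneg (o : EdgeOrientation G) (I : Set (Incidence G)) (u : stubbornSpace S)
    {α β : ℝ} (hα : 0 < α) (hβ : 0 < β)
    (w : freeSpace S × FrobHom (Cochain Fv) (Cochain Fe)) : 0 ≤ energyDecay o I u α β w := by
  unfold energyDecay
  positivity

theorem energyDecay_eq_zero {o : EdgeOrientation G} {I : Set (Incidence G)} {u : stubbornSpace S}
    {α β : ℝ} (hα : 0 < α) (hβ : 0 < β)
    {w : freeSpace S × FrobHom (Cochain Fv) (Cochain Fe)} (h : energyDecay o I u α β w = 0) :
    opinionGrad u w.1 w.2 = 0 ∧ structureGrad o I u w.1 w.2 = 0 := by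
  unfold energyDecay at h
  rw [add_eq_zero_iff_of_nonneg (by positivity) (by positivity)] at h
  simpa [hα.ne', hβ.ne'] using h

/-! ### Behaviour along solutions, local existence and convergence. -/

variable {o : EdgeOrientation G} {I : Set (Incidence G)} {u : stubbornSpace S} {α β : ℝ}
  {J : Set ℝ} {y : ℝ → freeSpace S} {δ : ℝ → FrobHom (Cochain Fv) (Cochain Fe)}

theorem IsTimeInterval.convex (hJ : IsTimeInterval J) : Convex ℝ J :=
  hJ.ordConnected.convex

theorem IsJointSolution.hasDerivWithinAt_disagreement (h : IsJointSolution o I u α β J y δ)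
    {t : ℝ} (ht : t ∈ J) :
    HasDerivWithinAt (fun t => disagreement u (y t) (δ t))
      (-energyDecay o I u α β (y t, δ t)) J t := by
  have hop : HasDerivWithinAt (fun t => opinion u (y t))
      ((-(α • opinionGrad u (y t) (δ t)) : freeSpace S) : Cochain Fv) J t :=
    ((freeSpace S).subtypeL.hasFDerivAt.comp_hasDerivWithinAt t
      (h.opinion_deriv t ht)).const_add _
  refine (FrobHom.hasDerivWithinAt_half_norm_sq (h.structure_deriv t ht) hop).congr_deriv ?_
  have h1 : ⟪FrobHom.toLin (δ t) (opinion u (y t)),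
      FrobHom.toLin (structureGrad o I u (y t) (δ t)) (opinion u (y t))⟫_ℝ =
      ‖structureGrad o I u (y t) (δ t)‖ ^ 2 := by
    rw [← real_inner_self_eq_norm_sq, inner_structureGrad,
      Submodule.starProjection_eq_self_iff.2 (structureGrad_mem o I u (y t) (δ t)),
      real_inner_comm]
  have h2 : ⟪FrobHom.toLin (δ t) (opinion u (y t)),
      FrobHom.toLin (δ t) (opinionGrad u (y t) (δ t) : Cochain Fv)⟫_ℝ =
      ‖opinionGrad u (y t) (δ t)‖ ^ 2 := by
    rw [← real_inner_self_eq_norm_sq, inner_opinionGrad, real_inner_comm]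
  rw [Submodule.coe_neg, Submodule.coe_smul, map_neg, map_smul, map_neg, map_smul,
    LinearMap.neg_apply, LinearMap.smul_apply, inner_neg_right, inner_neg_right,
    real_inner_smul_right, real_inner_smul_right, h1, h2, energyDecay]
  ring

theorem IsJointSolution.antitoneOn_disagreement (hα : 0 < α) (hβ : 0 < β) (hJ : IsTimeInterval J)
    (h : IsJointSolution o I u α β J y δ) :
    AntitoneOn (fun t => disagreement u (y t) (δ t)) J :=
  hJ.convex.antitoneOn_of_hasDerivWithinAt_nonpos
    (fun _ ht => h.hasDerivWithinAt_disagreement ht)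
    fun _ _ => neg_nonpos.2 (energyDecay_nonneg o I u hα hβ _)

theorem IsJointSolution.hasDerivWithinAt_norm_sq (h : IsJointSolution o I u α β J y δ)
    {t : ℝ} (ht : t ∈ J) :
    HasDerivWithinAt (fun t => ‖δ t‖ ^ 2)
      (-(2 * β * ⟪δ t, structureGrad o I u (y t) (δ t)⟫_ℝ)) J t := by
  refine (h.structure_deriv t ht).norm_sq.congr_deriv ?_
  rw [inner_neg_right, real_inner_smul_right]
  ring

theorem IsJointSolution.antitoneOn_norm (hβ : 0 < β) (hI : ∀ e, IsTypeS I e)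
    (hJ : IsTimeInterval J) (h : IsJointSolution o I u α β J y δ) :
    AntitoneOn (fun t => ‖δ t‖) J := by
  have := hJ.convex.antitoneOn_of_hasDerivWithinAt_nonpos
    (fun _ ht => h.hasDerivWithinAt_norm_sq ht)
    fun t ht => neg_nonpos.2 (mul_nonneg (by positivity)
      (inner_structureGrad_self_nonneg hI u (y t) (h.isCoboundary t ht)))
  exact fun s hs t ht hst => le_of_sq_le_sq (this hs ht hst) (norm_nonneg _)

/-- Local existence of solutions with given initial values. -/
theorem exists_isJointSolution (o : EdgeOrientation G) (I : Set (Incidence G))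
    (u : stubbornSpace S) (α β : ℝ) (y₀ : freeSpace S)
    {δ₀ : FrobHom (Cochain Fv) (Cochain Fe)} (hδ₀ : δ₀ ∈ coboundarySpace Fv Fe o) :
    ∃ ε > (0 : ℝ), ∃ (y : ℝ → freeSpace S) (δ : ℝ → FrobHom (Cochain Fv) (Cochain Fe)),
      y 0 = y₀ ∧ δ 0 = δ₀ ∧ IsJointSolution o I u α β (Icc 0 ε) y δ := by
  have : CompleteSpace (freeSpace S × FrobHom (Cochain Fv) (Cochain Fe)) :=
    FiniteDimensional.complete ℝ _
  obtain ⟨z, hz0, ε, hε, hz⟩ :=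
    ContDiffAt.exists_forall_mem_closedBall_exists_eq_forall_mem_Ioo_hasDerivAt₀
      ((contDiff_jointField o I u α β).contDiffAt (x := (y₀, δ₀))) 0
  -- The local solution lives on an open interval around 0; halving `ε` leaves a closed interval
  -- inside it.
  have hd : ∀ t ∈ Icc 0 (ε / 2), HasDerivWithinAt z (jointField o I u α β (z t)) (Icc 0 (ε / 2)) t :=
    fun t ht => (hz t ⟨by linarith [ht.1], by linarith [ht.2]⟩).hasDerivWithinAt
  have h1 : ∀ t ∈ Icc 0 (ε / 2), HasDerivWithinAt (fun t => (z t).1)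
      (-(α • opinionGrad u (z t).1 (z t).2)) (Icc 0 (ε / 2)) t := fun t ht =>
    (ContinuousLinearMap.fst ℝ (freeSpace S)
      (FrobHom (Cochain Fv) (Cochain Fe))).hasFDerivAt.comp_hasDerivWithinAt t (hd t ht)
  have h2 : ∀ t ∈ Icc 0 (ε / 2), HasDerivWithinAt (fun t => (z t).2)
      (-(β • structureGrad o I u (z t).1 (z t).2)) (Icc 0 (ε / 2)) t := fun t ht =>
    (ContinuousLinearMap.snd ℝ (freeSpace S)
      (FrobHom (Cochain Fv) (Cochain Fe))).hasFDerivAt.comp_hasDerivWithinAt t (hd t ht)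
  refine ⟨ε / 2, half_pos hε, fun t => (z t).1, fun t => (z t).2, by simp [hz0], by simp [hz0],
    fun t ht => ?_, h1, h2⟩
  -- The equation was solved among all linear maps; since velocities lie in M, `δ t - δ₀` does too,
  -- so `δ t` remains a coboundary.
  have hsub := velocitySpace_le_coboundarySpace o I
    (Submodule.sub_mem_of_hasDerivWithinAt (convex_Icc 0 (ε / 2)) h2
      (fun t _ => neg_mem (Submodule.smul_mem _ _ (structureGrad_mem o I u _ _)))
      (left_mem_Icc.2 (half_pos hε).le) ht)
  rw [hz0] at hsub
  simpa using add_mem hsub hδ₀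

theorem exists_not_antitoneOn_norm (hβ : 0 < β) (y₀ : freeSpace S)
    {δ₀ : FrobHom (Cochain Fv) (Cochain Fe)} (hδ₀ : δ₀ ∈ coboundarySpace Fv Fe o)
    (hneg : ⟪δ₀, structureGrad o I u y₀ δ₀⟫_ℝ < 0) :
    ∃ (J : Set ℝ) (y : ℝ → freeSpace S) (δ : ℝ → FrobHom (Cochain Fv) (Cochain Fe)),
      IsTimeInterval J ∧ IsJointSolution o I u α β J y δ ∧ ¬AntitoneOn (fun t => ‖δ t‖) J := by
  obtain ⟨ε, hε, y, δ, rfl, rfl, hsol⟩ := exists_isJointSolution o I u α β y₀ hδ₀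
  refine ⟨Icc 0 ε, y, δ, ⟨ordConnected_Icc, left_mem_Icc.2 hε.le, fun t ht => ht.1⟩, hsol,
    fun hanti => ?_⟩
  have hsq : AntitoneOn (fun t => ‖δ t‖ ^ 2) (Icc 0 ε) := fun s hs t ht hst =>
    pow_le_pow_left₀ (norm_nonneg _) (hanti hs ht hst) 2
  -- By `hneg`, ‖δ‖² has a strictly positive one-sided derivative at 0.
  have hd := hsol.hasDerivWithinAt_norm_sq (left_mem_Icc.2 hε.le)
  have h0 := hsq.derivWithin_nonpos (x := 0)
  rw [hd.derivWithin (uniqueDiffOn_Icc hε 0 (left_mem_Icc.2 hε.le))] at h0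
  nlinarith [mul_pos hβ (neg_pos.2 hneg)]

theorem isTypeS_of_antitoneOn_norm (hβ : 0 < β)
    (hI : ∀ e ∈ typeAEdges I, Nontrivial (Fe e) ∧
      ∀ v ∈ (e : Sym2 V), ∃ y : freeSpace S, opinion u y v ≠ 0)
    (h : ∀ (J : Set ℝ) (y : ℝ → freeSpace S) (δ : ℝ → FrobHom (Cochain Fv) (Cochain Fe)),
      IsTimeInterval J → IsJointSolution o I u α β J y δ → AntitoneOn (fun t => ‖δ t‖) J) :
    ∀ e, IsTypeS I e := by
  rw [forall_isTypeS_iff, eq_empty_iff_forall_notMem]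
  intro e he
  have := (hI e he).1
  obtain ⟨y₀, hy₀⟩ := exists_opinion_ne_zero (s := {v | v ∈ (e : Sym2 V)}) u (hI e he).2
  obtain ⟨δ₀, hδ₀, hneg⟩ := exists_inner_structureGrad_neg (Fe := Fe) (o := o) he u y₀ hy₀
  obtain ⟨J, y, δ, hJ, hsol, hnot⟩ := exists_not_antitoneOn_norm (α := α) hβ y₀ hδ₀ hneg
  exact hnot (h J y δ hJ hsol)

theorem isTypeS_of_forall_antitoneOn_norm (hβ : 0 < β)
    (hI : ∀ e ∈ typeAEdges I, Nontrivial (Fe e) ∧ ∀ v ∈ (e : Sym2 V), Nontrivial (Fv v))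
    (h : ∀ (u : stubbornSpace S) (J : Set ℝ) (y : ℝ → freeSpace S)
      (δ : ℝ → FrobHom (Cochain Fv) (Cochain Fe)),
      IsTimeInterval J → IsJointSolution o I u α β J y δ → AntitoneOn (fun t => ‖δ t‖) J) :
    ∀ e, IsTypeS I e := by
  classical
  rw [forall_isTypeS_iff, eq_empty_iff_forall_notMem]
  intro e he
  have := (hI e he).1
  -- Keeping the membership inside the existential makes the choice total, so that it defines a
  -- cochain.
  have hx : ∀ v, ∃ x : Fv v, v ∈ (e : Sym2 V) → x ≠ 0 := fun v => by
    by_cases hv : v ∈ (e : Sym2 V)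
    · have := (hI e he).2 v hv
      exact (exists_ne 0).imp fun x hx _ => hx
    · exact ⟨0, fun h => absurd h hv⟩
  choose x hx using hx
  obtain ⟨u, y₀, hxu⟩ := exists_opinion_eq S (WithLp.toLp 2 x)
  obtain ⟨δ₀, hδ₀, hneg⟩ := exists_inner_structureGrad_neg (Fe := Fe) (o := o) he u y₀
    fun v hv => by rw [hxu]; exact hx v hv
  obtain ⟨J, y, δ, hJ, hsol, hnot⟩ := exists_not_antitoneOn_norm (α := α) hβ y₀ hδ₀ hneg
  exact hnot (h u J y δ hJ hsol)

theorem IsJointSolution.tendsto_infEDist_equilibria (hα : 0 < α) (hβ : 0 < β)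
    (h : IsJointSolution o I u α β (Ici 0) y δ)
    (hcpt : IsCompact (closure ((fun t => (y t, δ t)) '' Ici (0 : ℝ)))) :
    Tendsto (fun t => Metric.infEDist (y t, δ t) (equilibria o I u α β (δ 0))) atTop (𝓝 0) := by
  -- Closedness carries both constraints over to limit points: they are coboundaries and differ from
  -- `δ 0` by an element of M.
  have hclosed : IsClosed {w : freeSpace S × FrobHom (Cochain Fv) (Cochain Fe) |
      w.2 ∈ coboundarySpace Fv Fe o ∧ w.2 - δ 0 ∈ velocitySpace Fv Fe o I} :=
    ((Submodule.closed_of_finiteDimensional _).preimage continuous_snd).inter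
      ((Submodule.closed_of_finiteDimensional _).preimage (continuous_snd.sub continuous_const))
  refine tendsto_infEDist_of_decay (contDiff_jointField o I u α β).continuous
    (fun t ht => (h.opinion_deriv t ht).prodMk (h.structure_deriv t ht))
    (continuous_disagreement u) (continuous_energyDecay o I u α β)
    (energyDecay_nonneg o I u hα hβ) (fun t ht => h.hasDerivWithinAt_disagreement ht) hcpt hclosed
    (fun t ht => ⟨h.isCoboundary t ht, Submodule.sub_mem_of_hasDerivWithinAt (convex_Ici 0)
      h.structure_deriv (fun t _ => neg_mem (Submodule.smul_mem _ _ (structureGrad_mem o I u _ _)))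
      self_mem_Ici ht⟩)
    fun w hw hD => ?_
  obtain ⟨h1, h2⟩ := energyDecay_eq_zero hα hβ hD
  exact ⟨hw.1, hw.2, by rw [h1, smul_zero, neg_zero], by rw [h2, smul_zero, neg_zero]⟩

end Dynamics

end

theorem mainTheorem3 {V : Type*} [Fintype V] (G : SimpleGraph V) [Fintype G.edgeSet]
    (Fv : V → Type*) [∀ v, NormedAddCommGroup (Fv v)] [∀ v, InnerProductSpace ℝ (Fv v)]
    [∀ v, FiniteDimensional ℝ (Fv v)]
    (Fe : G.edgeSet → Type*) [∀ e, NormedAddCommGroup (Fe e)]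
    [∀ e, InnerProductSpace ℝ (Fe e)] [∀ e, FiniteDimensional ℝ (Fe e)]
    (o : EdgeOrientation G) (I : Set (Incidence G)) (S : ∀ v, Submodule ℝ (Fv v))
    (α β : ℝ) (hα : 0 < α) (hβ : 0 < β) :
    -- the disagreement energy is nonincreasing along every solution
    (∀ (u : stubbornSpace S) (J : Set ℝ) (y : ℝ → freeSpace S)
        (δ : ℝ → FrobHom (Cochain Fv) (Cochain Fe)), IsTimeInterval J →
        IsJointSolution o I u α β J y δ →
        AntitoneOn (fun t => disagreement u (y t) (δ t)) J) ∧
    -- if every edge is Type S, the Frobenius norm is nonincreasing along every solution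
    ((∀ e, IsTypeS I e) → ∀ (u : stubbornSpace S) (J : Set ℝ) (y : ℝ → freeSpace S)
        (δ : ℝ → FrobHom (Cochain Fv) (Cochain Fe)), IsTimeInterval J →
        IsJointSolution o I u α β J y δ → AntitoneOn (fun t => ‖δ t‖) J) ∧
    -- equivalence for given stubborn opinions, when each Type A edge has a nonzero stalk and
    -- opinions at its endpoints that are not forced to vanish
    (∀ u : stubbornSpace S,
      (∀ e ∈ typeAEdges I, Nontrivial (Fe e) ∧
        ∀ v ∈ (e : Sym2 V), ∃ y : freeSpace S, opinion u y v ≠ 0) →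
      ((∀ (J : Set ℝ) (y : ℝ → freeSpace S)
          (δ : ℝ → FrobHom (Cochain Fv) (Cochain Fe)), IsTimeInterval J →
          IsJointSolution o I u α β J y δ → AntitoneOn (fun t => ‖δ t‖) J) ↔
        ∀ e, IsTypeS I e)) ∧
    -- equivalence over all stubborn opinions, when the stalks on Type A edges and at their
    -- endpoints are nonzero
    ((∀ e ∈ typeAEdges I, Nontrivial (Fe e) ∧ ∀ v ∈ (e : Sym2 V), Nontrivial (Fv v)) →
      ((∀ (u : stubbornSpace S) (J : Set ℝ) (y : ℝ → freeSpace S)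
          (δ : ℝ → FrobHom (Cochain Fv) (Cochain Fe)), IsTimeInterval J →
          IsJointSolution o I u α β J y δ → AntitoneOn (fun t => ‖δ t‖) J) ↔
        ∀ e, IsTypeS I e)) ∧
    -- every edge is Type S exactly when there is no Type A edge
    ((∀ e, IsTypeS I e) ↔ typeAEdges I = ∅) ∧
    -- a precompact forward orbit converges to the set of equilibria
    (∀ (u : stubbornSpace S) (y : ℝ → freeSpace S)
        (δ : ℝ → FrobHom (Cochain Fv) (Cochain Fe)),
        IsJointSolution o I u α β (Ici 0) y δ →
        IsCompact (closure ((fun t => (y t, δ t)) '' Ici (0 : ℝ))) →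
        Tendsto (fun t => Metric.infEDist (y t, δ t) (equilibria o I u α β (δ 0)))
          atTop (𝓝 0)) := by
  refine ⟨fun u J y δ hJ h => h.antitoneOn_disagreement hα hβ hJ,
    fun hI u J y δ hJ h => h.antitoneOn_norm hβ hI hJ,
    fun u hI => ⟨isTypeS_of_antitoneOn_norm hβ hI,
      fun hS J y δ hJ h => h.antitoneOn_norm hβ hS hJ⟩,
    fun hI => ⟨isTypeS_of_forall_antitoneOn_norm hβ hI,
      fun hS u J y δ hJ h => h.antitoneOn_norm hβ hS hJ⟩,
    forall_isTypeS_iff I, fun u y δ h hcpt => h.tendsto_infEDist_equilibria hα hβ hcpt⟩
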